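/- Let $n\ge 1$, let $\Omega\subset\mathbb R^n$ be a bounded open set, let $f,u_d\in L^2(\Omega)$ be real valued, let $0\le a<b\le 1$, and let $\varphi\in C^2(a,b)$ be nonnegative and convex with $\varphi(s)\to+\infty$ as $s\downarrow a$ and as $s\uparrow b$. Let $-\Delta$ be the Dirichlet Laplacian: $\mu$ is an eigenvalue with eigenfunction $0\neq w\in H_0^1(\Omega)$ if $\int_\Omega\nabla w\cdot\nabla v\,dx=\mu\int_\Omega wv\,dx$ for all $v\in H_0^1(\Omega)$. Let $(\varphi_k)_k$ be an orthonormal basis of $L^2(\Omega)$ of eigenfunctions, with eigenvalues $\lambda_k>0$. Write $w_k=(w,\varphi_k)_{L^2(\Omega)}$ for $w\in L^2(\Omega)$, and put $$\mathbb H^s(\Omega)=\Big\{w\in L^2(\Omega):\sum_k\lambda_k^s w_k^2<\infty\Big\},\qquad \mathcal S(s)=\sum_k\lambda_k^{-s}f_k\varphi_k\quad(0<s<1),$$ so that $u=\mathcal S(s)$ solves $(-\Delta)^su=f$ (neither object depends on the choice of the basis). Let $$J(s,u)=\tfrac12\|u-u_d\|_{L^2(\Omega)}^2+\varphi(s).$$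 A pair $(s,u)$ is admissible if $s\in(a,b)$, $u\in\mathbb H^s(\Omega)$ and $u=\mathcal S(s)$. An admissible pair $(\bar s,\bar u)$ is optimal if $J(\bar s,\bar u)\le J(s,u)$ for all admissible $(s,u)$. It is strictly locally optimal if there is $\delta>0$ such that $J(\bar s,\bar u)<J(s,u)$ for all admissible $(s,u)$ with $0<|s-\bar s|<\delta$. Then the series for $\mathcal S(s)$ converges in $L^2(\Omega)$ for every $s\in(0,1)$, and $\mathcal S:(0,1)\to L^2(\Omega)$ is twice continuously differentiable. Write $D_s\bar u=\mathcal S'(\bar s)$ and $D_s^2\bar u=\mathcal S''(\bar s)$. (i) Every optimal pair $(\bar s,\bar u)$ satisfies $$(\bar u-u_d,D_s\bar u)_{L^2(\Omega)}+\varphi'(\bar s)=0.\tag{1}$$ (ii) If $\bar s\in(a,b)$ and $\bar u=\mathcal S(\bar s)$ satisfy (1) and $$\|D_s\bar u\|_{L^2(\Omega)}^2+(\bar u-u_d,D_s^2\bar u)_{L^2(\Omega)}+\varphi''(\bar s)>0,$$ then $(\bar s,\bar u)$ is a strictly locally optimal pair. -/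

import Mathlib

open Set Filter Topology MeasureTheory
open scoped ContDiff RealInnerProductSpace

namespace FracIdent

noncomputable section

/-- The ambient space `ℝⁿ`. -/
abbrev Rn (n : ℕ) : Type := EuclideanSpace ℝ (Fin n)

/-- The Hilbert space `L²(Ω)` of real functions. -/
abbrev L2 {n : ℕ} (Ω : Set (Rn n)) : Type := Lp ℝ 2 (volume.restrict Ω)

/-- The Hilbert space `L²(Ω; ℝⁿ)` of vector fields. -/
abbrev L2vec {n : ℕ} (Ω : Set (Rn n)) : Type := Lp (Rn n) 2 (volume.restrict Ω)

/-- `ψ ∈ C₀^∞(Ω)`: smooth with compact support contained in `Ω`. -/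
def IsTest {n : ℕ} (Ω : Set (Rn n)) (ψ : Rn n → ℝ) : Prop :=
  ContDiff ℝ ∞ ψ ∧ HasCompactSupport ψ ∧ tsupport ψ ⊆ Ω

theorem gradient_add_of_test {n : ℕ} {Ω : Set (Rn n)} {ψ χ : Rn n → ℝ}
    (hψ : IsTest Ω ψ) (hχ : IsTest Ω χ) (x : Rn n) :
    gradient (ψ + χ) x = gradient ψ x + gradient χ x := by
  have h1 : DifferentiableAt ℝ ψ x := (hψ.1.differentiable (by simp)) x
  have h2 : DifferentiableAt ℝ χ x := (hχ.1.differentiable (by simp)) x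
  simp [gradient, fderiv_add h1 h2]

theorem gradient_smul_of_test {n : ℕ} {Ω : Set (Rn n)} {ψ : Rn n → ℝ}
    (hψ : IsTest Ω ψ) (c : ℝ) (x : Rn n) :
    gradient (c • ψ) x = c • gradient ψ x := by
  have h1 : DifferentiableAt ℝ ψ x := (hψ.1.differentiable (by simp)) x
  simp [gradient, fderiv_const_smul h1 c]

/-- The pairs `(ψ, ∇ψ)` in `L²(Ω) × L²(Ω; ℝⁿ)` with `ψ ∈ C₀^∞(Ω)`. -/
def testGraph {n : ℕ} (Ω : Set (Rn n)) : Submodule ℝ (L2 Ω × L2vec Ω) where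
  carrier := {p | ∃ ψ : Rn n → ℝ, IsTest Ω ψ ∧
    (p.1 : Rn n → ℝ) =ᵐ[volume.restrict Ω] ψ ∧
    (p.2 : Rn n → Rn n) =ᵐ[volume.restrict Ω] gradient ψ}
  zero_mem' := by
    refine ⟨0, ⟨contDiff_const, HasCompactSupport.zero, by simp⟩, Lp.coeFn_zero _ _ _, ?_⟩
    refine (Lp.coeFn_zero _ _ _).trans (Eventually.of_forall fun x => ?_)
    simp [gradient]
  add_mem' := by
    rintro p q ⟨ψ, hψ, h1, h2⟩ ⟨χ, hχ, k1, k2⟩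
    refine ⟨ψ + χ, ⟨hψ.1.add hχ.1, hψ.2.1.add hχ.2.1,
      (tsupport_add ψ χ).trans (union_subset hψ.2.2 hχ.2.2)⟩, ?_, ?_⟩
    · exact (Lp.coeFn_add _ _).trans (h1.add k1)
    · refine (Lp.coeFn_add _ _).trans ((h2.add k2).trans (Eventually.of_forall fun x => ?_))
      exact (gradient_add_of_test hψ hχ x).symm
  smul_mem' := by
    rintro c p ⟨ψ, hψ, h1, h2⟩
    refine ⟨c • ψ, ⟨hψ.1.const_smul c, hψ.2.1.smul_left (f := fun _ => c),
      (tsupport_smul_subset_right (fun _ => c) ψ).trans hψ.2.2⟩, ?_, ?_⟩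
    · exact (Lp.coeFn_smul _ _).trans (h1.const_smul c)
    · refine (Lp.coeFn_smul _ _).trans ((h2.const_smul c).trans (Eventually.of_forall fun x => ?_))
      exact (gradient_smul_of_test hψ c x).symm

/-- The Sobolev space `H₀¹(Ω)`, the closure of `C₀^∞(Ω)` in the `H¹` norm, given as the space of
pairs `(u, ∇u)` with `u ∈ H₀¹(Ω)` and `∇u` its weak gradient. -/
def H10 {n : ℕ} (Ω : Set (Rn n)) : Submodule ℝ (L2 Ω × L2vec Ω) :=
  (testGraph Ω).topologicalClosure

/-- The pairs `(u, ∇u)`, `u ∈ H₀¹(Ω)`, for which `-Δ u = μ u` in `Ω`, `u = 0` on `∂Ω`, in the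
weak sense: `(∇u, ∇v) = μ (u, v)` for all `v ∈ H₀¹(Ω)`. -/
def eigenGraph {n : ℕ} (Ω : Set (Rn n)) (μ : ℝ) : Submodule ℝ (L2 Ω × L2vec Ω) where
  carrier := {p | p ∈ H10 Ω ∧ ∀ q ∈ H10 Ω, ⟪p.2, q.2⟫ = μ * ⟪p.1, q.1⟫}
  zero_mem' := ⟨zero_mem _, fun q _ => by simp⟩
  add_mem' := by
    rintro p q ⟨hp, hp'⟩ ⟨hq, hq'⟩
    refine ⟨add_mem hp hq, fun r hr => ?_⟩
    simp only [Prod.snd_add, Prod.fst_add, inner_add_left, hp' r hr, hq' r hr]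
    ring
  smul_mem' := by
    rintro c p ⟨hp, hp'⟩
    refine ⟨Submodule.smul_mem _ c hp, fun r hr => ?_⟩
    simp only [Prod.smul_snd, Prod.smul_fst, real_inner_smul_left, hp' r hr]
    ring

/-- The space of all `u ∈ H₀¹(Ω)` with `-Δ u = μ u` weakly, as a subspace of `L²(Ω)`. -/
def eigenspace {n : ℕ} (Ω : Set (Rn n)) (μ : ℝ) : Submodule ℝ (L2 Ω) :=
  (eigenGraph Ω μ).map (LinearMap.fst ℝ (L2 Ω) (L2vec Ω))

theorem isClosed_eigenGraph {n : ℕ} (Ω : Set (Rn n)) (μ : ℝ) :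
    IsClosed (eigenGraph Ω μ : Set (L2 Ω × L2vec Ω)) := by
  have h : (eigenGraph Ω μ : Set (L2 Ω × L2vec Ω)) =
      (H10 Ω : Set (L2 Ω × L2vec Ω)) ∩
        ⋂ q ∈ H10 Ω, {p : L2 Ω × L2vec Ω | ⟪p.2, q.2⟫ = μ * ⟪p.1, q.1⟫} := by
    ext p
    simp [eigenGraph]
  rw [h]
  refine (Submodule.isClosed_topologicalClosure _).inter ?_
  refine isClosed_biInter fun q _ => isClosed_eq ?_ ?_
  · exact continuous_snd.inner continuous_const
  · exact continuous_const.mul (continuous_fst.inner continuous_const)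

theorem norm_snd_of_mem_eigenGraph {n : ℕ} {Ω : Set (Rn n)} {μ : ℝ} {p : L2 Ω × L2vec Ω}
    (hp : p ∈ eigenGraph Ω μ) : ‖p.2‖ ≤ √|μ| * ‖p.1‖ := by
  have h := hp.2 p hp.1
  rw [real_inner_self_eq_norm_sq, real_inner_self_eq_norm_sq] at h
  refine abs_le_of_sq_le_sq' ?_ (by positivity) |>.2
  rw [h, mul_pow, Real.sq_sqrt (abs_nonneg μ)]
  exact mul_le_mul_of_nonneg_right (le_abs_self μ) (by positivity)

theorem isComplete_eigenspace {n : ℕ} (Ω : Set (Rn n)) (μ : ℝ) :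
    IsComplete (eigenspace Ω μ : Set (L2 Ω)) := by
  have hc : CompleteSpace (eigenGraph Ω μ) := (isClosed_eigenGraph Ω μ).completeSpace_coe
  let F : eigenGraph Ω μ →ₗ[ℝ] L2 Ω := (LinearMap.fst ℝ (L2 Ω) (L2vec Ω)).domRestrict _
  have hF : UniformContinuous F :=
    uniformContinuous_fst.comp uniformContinuous_subtype_val
  have hA : AntilipschitzWith (Real.toNNReal (max 1 √|μ|)) F := by
    refine AddMonoidHomClass.antilipschitz_of_bound F fun x => ?_
    have h2 := norm_snd_of_mem_eigenGraph x.2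
    have h3 : (0 : ℝ) ≤ ‖(x : L2 Ω × L2vec Ω).1‖ := norm_nonneg _
    rw [Real.coe_toNNReal _ (by positivity)]
    change ‖(x : L2 Ω × L2vec Ω)‖ ≤ max 1 √|μ| * ‖(x : L2 Ω × L2vec Ω).1‖
    rw [Prod.norm_def]
    refine max_le ?_ (h2.trans ?_)
    · nlinarith [le_max_left 1 √|μ|]
    · exact mul_le_mul_of_nonneg_right (le_max_right _ _) h3
  have hr := (hA.isComplete_range hF)
  have he : (eigenspace Ω μ : Set (L2 Ω)) = Set.range F := by
    ext u
    simp [eigenspace, F]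
  rw [he]
  exact hr

instance {n : ℕ} (Ω : Set (Rn n)) (μ : ℝ) : CompleteSpace (eigenspace Ω μ) :=
  (isComplete_eigenspace Ω μ).completeSpace_coe

/-- The eigenvalues of the Dirichlet Laplacian `-Δ` in `Ω`. -/
def Eigenvalue {n : ℕ} (Ω : Set (Rn n)) : Type := {μ : ℝ // eigenspace Ω μ ≠ ⊥}

/-- The component `P_μ w` of `w` in the eigenspace of `μ`: the `L²(Ω)`-orthogonal projection. For
every orthonormal basis `(φ_k)` of eigenfunctions with eigenvalues `λ_k` it is
`∑_{k : λ_k = μ} (w, φ_k) φ_k`. -/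
def eigenProj {n : ℕ} (Ω : Set (Rn n)) (μ : Eigenvalue Ω) (w : L2 Ω) : L2 Ω :=
  (eigenspace Ω μ.1).starProjection w

/-- The space `ℍ^s(Ω)` of the `w ∈ L²(Ω)` with `∑_k λ_k^s w_k² < ∞`. The terms are grouped by
eigenvalue: `∑_{k : λ_k = μ} w_k² = ‖P_μ w‖²`. -/
def Hs {n : ℕ} (Ω : Set (Rn n)) (s : ℝ) : Set (L2 Ω) :=
  {w | Summable fun μ : Eigenvalue Ω => μ.1 ^ s * ‖eigenProj Ω μ w‖ ^ 2}

/-- The terms `λ^{-s} P_λ f` of the series for the solution of `(-Δ)^s u = f`. -/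
def stateTerm {n : ℕ} (Ω : Set (Rn n)) (f : L2 Ω) (s : ℝ) (μ : Eigenvalue Ω) : L2 Ω :=
  μ.1 ^ (-s) • eigenProj Ω μ f

/-- The control to state map `S(s) = (-Δ)^{-s} f = ∑_k λ_k^{-s} f_k φ_k`, with values in `L²(Ω)`;
the terms are grouped by eigenvalue. -/
def controlToState {n : ℕ} (Ω : Set (Rn n)) (f : L2 Ω) (s : ℝ) : L2 Ω :=
  ∑' μ : Eigenvalue Ω, stateTerm Ω f s μ

/-- The cost functional `J(s, u) = ½ ‖u - u_d‖² + φ(s)`. -/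
def cost {n : ℕ} {Ω : Set (Rn n)} (ud : L2 Ω) (φ : ℝ → ℝ) (s : ℝ) (u : L2 Ω) : ℝ :=
  1 / 2 * ‖u - ud‖ ^ 2 + φ s

/-- `(s, u)` is admissible: `s ∈ (a, b)`, `u ∈ ℍ^s(Ω)` and `u = S(s)`. -/
def IsAdmissible {n : ℕ} (Ω : Set (Rn n)) (f : L2 Ω) (a b s : ℝ) (u : L2 Ω) : Prop :=
  s ∈ Ioo a b ∧ u ∈ Hs Ω s ∧ u = controlToState Ω f s

/-- Optimal pairs: admissible pairs that minimise the cost among all admissible pairs. -/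
def IsOptimalPair {n : ℕ} (Ω : Set (Rn n)) (f ud : L2 Ω) (φ : ℝ → ℝ) (a b : ℝ)
    (sbar : ℝ) (ubar : L2 Ω) : Prop :=
  IsAdmissible Ω f a b sbar ubar ∧
    ∀ (s : ℝ) (u : L2 Ω), IsAdmissible Ω f a b s u → cost ud φ sbar ubar ≤ cost ud φ s u

/-- Strictly locally optimal pairs: admissible pairs whose cost is smaller than that of every
other admissible pair with a control `s` close to `sbar`. -/
def IsStrictLocallyOptimalPair {n : ℕ} (Ω : Set (Rn n)) (f ud : L2 Ω) (φ : ℝ → ℝ) (a b : ℝ)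
    (sbar : ℝ) (ubar : L2 Ω) : Prop :=
  IsAdmissible Ω f a b sbar ubar ∧
    ∃ δ > 0, ∀ (s : ℝ) (u : L2 Ω), IsAdmissible Ω f a b s u → |s - sbar| < δ → s ≠ sbar →
      cost ud φ sbar ubar < cost ud φ s u

/-- `(ū - u_d, D_s ū) + φ'(s̄) = 0`, where `D_s ū` is the derivative of `S` at `s̄`. -/
def FirstOrder {n : ℕ} (Ω : Set (Rn n)) (f ud : L2 Ω) (φ : ℝ → ℝ)
    (sbar : ℝ) (ubar : L2 Ω) : Prop :=
  ⟪ubar - ud, deriv (controlToState Ω f) sbar⟫ + deriv φ sbar = 0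

/-- `(D_s ū, D_s ū) + (ū - u_d, D_s² ū) + φ''(s̄) > 0`. -/
def SecondOrder {n : ℕ} (Ω : Set (Rn n)) (f ud : L2 Ω) (φ : ℝ → ℝ)
    (sbar : ℝ) (ubar : L2 Ω) : Prop :=
  0 < ⟪deriv (controlToState Ω f) sbar, deriv (controlToState Ω f) sbar⟫
    + ⟪ubar - ud, iteratedDeriv 2 (controlToState Ω f) sbar⟫ + iteratedDeriv 2 φ sbar

end

end FracIdent

/-!
The argument is spectral and needs only two facts about the Dirichlet Laplacian. First, its
eigenvalues are bounded below by some `c > 0` (`exists_pos_le_eigenvalue`), which is the Poincaré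
inequality on a bounded set. Second, eigenspaces for different eigenvalues are orthogonal in `L²(Ω)`
(`orthogonalFamily_eigenspace`). By Bessel's inequality every bounded function `g` of the eigenvalue
then defines a convergent sum `∑_λ g(λ) P_λ f` of norm at most `sup |g| * ‖f‖`. Neither the
completeness of the eigenfunctions nor the discreteness of the spectrum plays a role.

The coefficients `(-log λ)^j λ^{-s}` are bounded on `λ ≥ c` for every `s > 0`, and their first order
Taylor remainders in `s` are `O((t - s)²)` uniformly in `λ ≥ c` (`exists_abs_taylor_exp_le`). Hence
`S_j(s) = ∑_λ (-log λ)^j λ^{-s} P_λ f` has the derivative `S_{j+1}` (`hasDerivAt_stateDeriv`), and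
the control to state map `S = S_0` is smooth on `(0, ∞)`. The bound on `λ^{-s}` also shows that `S(s)`
lies in `ℍ^s(Ω)`, so that every `s ∈ (a, b)` gives an admissible pair.

The optimisation problem is thereby that of the real function `s ↦ J(s, S(s))` on the open interval
`(a, b)`. The first order condition says that its derivative vanishes, and the expression in the
second order condition is its second derivative. The two claims are Fermat's theorem and the strict
second derivative test (`eventually_lt_of_deriv_deriv_pos`).
-/

namespace FracIdent

/-! ### Poincaré inequality and Dirichlet eigenvalues -/

/-- A Poincaré inequality for compactly supported functions: integrate `ℓ * ∂_v (ψ²)` by parts, where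
`∂_v ℓ = 1`, and absorb half of `∫ ψ²` by Young's inequality. -/
theorem integral_sq_le_integral_norm_fderiv_sq {E : Type*} [NormedAddCommGroup E]
    [NormedSpace ℝ E] [FiniteDimensional ℝ E] [MeasurableSpace E] [BorelSpace E]
    (μ : Measure E) [μ.IsAddHaarMeasure] {ℓ : E →L[ℝ] ℝ} {v : E} (hv : ‖v‖ = 1) (hℓv : ℓ v = 1)
    {ψ : E → ℝ} (hψ : ContDiff ℝ 1 ψ) (hcomp : HasCompactSupport ψ) {R : ℝ}
    (hR : ∀ x ∈ tsupport ψ, |ℓ x| ≤ R) :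
    ∫ x, ψ x ^ 2 ∂μ ≤ 4 * R ^ 2 * ∫ x, ‖fderiv ℝ ψ x‖ ^ 2 ∂μ := by
  have hdiff : Differentiable ℝ ψ := hψ.differentiable one_ne_zero
  have hcψ : Continuous ψ := hψ.continuous
  have hcf : Continuous (fderiv ℝ ψ) := hψ.continuous_fderiv one_ne_zero
  have hfd : ∀ x, fderiv ℝ (fun y => ψ y ^ 2) x v = 2 * ψ x * fderiv ℝ ψ x v := fun x => by
    rw [fderiv_fun_pow 2 (hdiff x)]
    simp
  have hsq : HasCompactSupport fun x => ψ x ^ 2 :=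
    hcomp.comp_left (g := fun t : ℝ => t ^ 2) (by simp)
  have hIψ : Integrable (fun x => ψ x ^ 2) μ :=
    (hcψ.pow 2).integrable_of_hasCompactSupport hsq
  have hfsq : HasCompactSupport fun x => ‖fderiv ℝ ψ x‖ ^ 2 :=
    (hcomp.fderiv ℝ).norm.comp_left (g := fun t : ℝ => t ^ 2) (by simp)
  have hIf : Integrable (fun x => ‖fderiv ℝ ψ x‖ ^ 2) μ :=
    (hcf.norm.pow 2).integrable_of_hasCompactSupport hfsq
  have hIp : Integrable (fun x => ℓ x * (2 * ψ x * fderiv ℝ ψ x v)) μ := by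
    refine Continuous.integrable_of_hasCompactSupport (by fun_prop) ?_
    exact ((hcomp.mul_left (f := fun _ => (2 : ℝ))).mul_right).mul_left
  have hIB := integral_mul_fderiv_eq_neg_fderiv_mul_of_integrable (μ := μ)
    (f := fun x => ℓ x) (g := fun x => ψ x ^ 2) (v := v)
    (by simpa [hℓv] using hIψ) (by simpa only [hfd] using hIp)
    ((ℓ.continuous.mul (hcψ.pow 2)).integrable_of_hasCompactSupport hsq.mul_left)
    (fun x _ => ℓ.differentiableAt) (fun x _ => (hdiff x).pow 2)
  simp only [hfd, ContinuousLinearMap.fderiv, hℓv, one_mul] at hIB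
  -- Young's inequality; the weights leave the factor `1 / 2` in front of `∫ ψ²`.
  have hpt : ∀ x, -(ℓ x * (2 * ψ x * fderiv ℝ ψ x v))
      ≤ 1 / 2 * ψ x ^ 2 + 2 * R ^ 2 * ‖fderiv ℝ ψ x‖ ^ 2 := by
    intro x
    by_cases hx : x ∈ tsupport ψ
    · have h1 : |ℓ x| ^ 2 ≤ R ^ 2 := pow_le_pow_left₀ (abs_nonneg _) (hR x hx) 2
      have h2 : |fderiv ℝ ψ x v| ^ 2 ≤ ‖fderiv ℝ ψ x‖ ^ 2 := by
        refine pow_le_pow_left₀ (abs_nonneg _) ?_ 2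
        simpa [hv] using (fderiv ℝ ψ x).le_opNorm v
      have h3 := mul_le_mul h1 h2 (sq_nonneg _) (sq_nonneg _)
      rw [sq_abs, sq_abs] at h3
      linarith [sq_nonneg (ψ x + 2 * (ℓ x * fderiv ℝ ψ x v))]
    · rw [image_eq_zero_of_notMem_tsupport hx]
      have : 0 ≤ R ^ 2 * ‖fderiv ℝ ψ x‖ ^ 2 := by positivity
      linarith
  have hle : ∫ x, ψ x ^ 2 ∂μ
      ≤ 1 / 2 * (∫ x, ψ x ^ 2 ∂μ) + 2 * R ^ 2 * ∫ x, ‖fderiv ℝ ψ x‖ ^ 2 ∂μ := by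
    rw [← integral_const_mul, ← integral_const_mul,
      ← integral_add (hIψ.const_mul _) (hIf.const_mul _)]
    calc ∫ x, ψ x ^ 2 ∂μ = ∫ x, -(ℓ x * (2 * ψ x * fderiv ℝ ψ x v)) ∂μ := by
          rw [integral_neg, hIB, neg_neg]
      _ ≤ _ := integral_mono hIp.neg ((hIψ.const_mul _).add (hIf.const_mul _)) hpt
  linarith

theorem IsTest.integral_sq_le {n : ℕ} {Ω : Set (Rn n)} (hn : 1 ≤ n) {R : ℝ}
    (hR : ∀ x ∈ Ω, ‖x‖ ≤ R) {ψ : Rn n → ℝ} (hψ : IsTest Ω ψ) :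
    ∫ x in Ω, ψ x ^ 2 ≤ 4 * R ^ 2 * ∫ x in Ω, ‖gradient ψ x‖ ^ 2 := by
  obtain ⟨hsmooth, hcomp, hsupp⟩ := hψ
  have hg : ∀ x, ‖gradient ψ x‖ = ‖fderiv ℝ ψ x‖ := fun x => by simp [gradient]
  have hzero : ∀ x, x ∉ Ω → ψ x ^ 2 = 0 := fun x hx => by
    rw [image_eq_zero_of_notMem_tsupport fun h => hx (hsupp h), zero_pow two_ne_zero]
  have hfzero : ∀ x, x ∉ Ω → ‖fderiv ℝ ψ x‖ ^ 2 = 0 := fun x hx => by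
    rw [fderiv_of_notMem_tsupport ℝ fun h => hx (hsupp h), norm_zero, zero_pow two_ne_zero]
  simp only [hg]
  rw [setIntegral_eq_integral_of_forall_compl_eq_zero hzero,
    setIntegral_eq_integral_of_forall_compl_eq_zero hfzero]
  exact integral_sq_le_integral_norm_fderiv_sq volume
    (ℓ := EuclideanSpace.proj (⟨0, hn⟩ : Fin n)) (v := EuclideanSpace.single ⟨0, hn⟩ 1)
    (by simp) (by simp) (hsmooth.of_le (by simp)) hcomp
    fun x hx => (PiLp.norm_apply_le x _).trans (hR x (hsupp hx))

/-- The Poincaré inequality on `H₀¹(Ω)`; it passes from test functions to their closure. -/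
theorem norm_fst_le_of_mem_H10 {n : ℕ} {Ω : Set (Rn n)} (hn : 1 ≤ n) {R : ℝ} (hR0 : 0 ≤ R)
    (hR : ∀ x ∈ Ω, ‖x‖ ≤ R) {p : L2 Ω × L2vec Ω} (hp : p ∈ H10 Ω) :
    ‖p.1‖ ≤ 2 * R * ‖p.2‖ := by
  have hcl : IsClosed {p : L2 Ω × L2vec Ω | ‖p.1‖ ≤ 2 * R * ‖p.2‖} :=
    isClosed_le continuous_fst.norm (continuous_const.mul continuous_snd.norm)
  refine closure_minimal ?_ hcl hp
  rintro q ⟨ψ, hψ, h1, h2⟩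
  have e1 : ‖q.1‖ ^ 2 = ∫ x in Ω, ψ x ^ 2 := by
    rw [← real_inner_self_eq_norm_sq, L2.inner_def]
    refine integral_congr_ae (h1.mono fun x hx => ?_)
    simp only [hx, real_inner_self_eq_norm_sq, Real.norm_eq_abs, sq_abs]
  have e2 : ‖q.2‖ ^ 2 = ∫ x in Ω, ‖gradient ψ x‖ ^ 2 := by
    rw [← real_inner_self_eq_norm_sq, L2.inner_def]
    refine integral_congr_ae (h2.mono fun x hx => ?_)
    simp only [hx, real_inner_self_eq_norm_sq]
  refine (pow_le_pow_iff_left₀ (norm_nonneg _) (by positivity) two_ne_zero).1 ?_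
  calc ‖q.1‖ ^ 2 ≤ 4 * R ^ 2 * ‖q.2‖ ^ 2 := by
        rw [e1, e2]
        exact hψ.integral_sq_le hn hR
    _ = (2 * R * ‖q.2‖) ^ 2 := by ring

/-- The Dirichlet eigenvalues of a bounded set are bounded away from zero: the Poincaré inequality
bounds the Rayleigh quotient of an eigenfunction from below. -/
theorem exists_pos_le_eigenvalue {n : ℕ} {Ω : Set (Rn n)} (hn : 1 ≤ n)
    (hΩ : Bornology.IsBounded Ω) : ∃ c > 0, ∀ μ : Eigenvalue Ω, c ≤ μ.1 := by
  obtain ⟨R, hRpos, hR⟩ := hΩ.exists_pos_norm_le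
  refine ⟨1 / (4 * R ^ 2), by positivity, fun μ => ?_⟩
  obtain ⟨u, ⟨p, hp, rfl⟩, hu⟩ := Submodule.exists_mem_ne_zero_of_ne_bot μ.2
  have hpos : 0 < ‖p.1‖ ^ 2 := pow_pos (norm_pos_iff.2 hu) 2
  have h1 := hp.2 p hp.1
  rw [real_inner_self_eq_norm_sq, real_inner_self_eq_norm_sq] at h1
  have h2 : ‖p.1‖ ^ 2 ≤ (2 * R * ‖p.2‖) ^ 2 :=
    pow_le_pow_left₀ (norm_nonneg _) (norm_fst_le_of_mem_H10 hn hRpos.le hR hp.1) 2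
  rw [div_le_iff₀ (by positivity)]
  refine le_of_mul_le_mul_right ?_ hpos
  calc 1 * ‖p.1‖ ^ 2 ≤ 4 * R ^ 2 * ‖p.2‖ ^ 2 := by linarith
    _ = _ := by rw [h1]; ring

theorem orthogonalFamily_eigenspace {n : ℕ} (Ω : Set (Rn n)) :
    OrthogonalFamily ℝ (fun μ : Eigenvalue Ω => eigenspace Ω μ.1)
      fun μ => (eigenspace Ω μ.1).subtypeₗᵢ := by
  rintro μ ν hne ⟨u, p, hp, rfl⟩ ⟨w, q, hq, rfl⟩
  change ⟪p.1, q.1⟫ = 0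
  have h1 := hp.2 q hq.1
  have h2 := hq.2 p hp.1
  rw [real_inner_comm p.2, real_inner_comm p.1, h1] at h2
  have h3 : (μ.1 - ν.1) * ⟪p.1, q.1⟫ = 0 := by linarith
  exact (mul_eq_zero.1 h3).resolve_left fun h => hne (Subtype.ext (sub_eq_zero.1 h))

/-! ### Multipliers of an orthogonal family of subspaces -/

section Multiplier

variable {H ι : Type*} [NormedAddCommGroup H] [InnerProductSpace ℝ H] {V : ι → Submodule ℝ H}
  [∀ i, (V i).HasOrthogonalProjection]

/-- Bessel's inequality for the projections onto an orthogonal family of subspaces. -/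
theorem sum_norm_sq_starProjection_le
    (hV : OrthogonalFamily ℝ (fun i => V i) fun i => (V i).subtypeₗᵢ) (w : H) (s : Finset ι) :
    ∑ i ∈ s, ‖(V i).starProjection w‖ ^ 2 ≤ ‖w‖ ^ 2 := by
  have h1 : ‖∑ i ∈ s, (V i).starProjection w‖ ^ 2 = ∑ i ∈ s, ‖(V i).starProjection w‖ ^ 2 :=
    hV.norm_sum (fun i => (V i).orthogonalProjectionOnto w) s
  have h2 : ⟪w, ∑ i ∈ s, (V i).starProjection w⟫ = ∑ i ∈ s, ‖(V i).starProjection w‖ ^ 2 := by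
    rw [inner_sum]
    refine Finset.sum_congr rfl fun i _ => ?_
    rw [← real_inner_self_eq_norm_sq, Submodule.inner_starProjection_left_eq_right,
      Submodule.starProjection_eq_self_iff.2 (Submodule.starProjection_apply_mem _ _)]
  have h3 := real_inner_le_norm w (∑ i ∈ s, (V i).starProjection w)
  rw [h2, ← h1] at h3
  rw [← h1]
  nlinarith [norm_nonneg w, norm_nonneg (∑ i ∈ s, (V i).starProjection w)]

theorem summable_norm_sq_starProjection
    (hV : OrthogonalFamily ℝ (fun i => V i) fun i => (V i).subtypeₗᵢ) (w : H) :
    Summable fun i => ‖(V i).starProjection w‖ ^ 2 :=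
  summable_of_sum_le (fun _ => sq_nonneg _) (sum_norm_sq_starProjection_le hV w)

theorem norm_sum_smul_starProjection_le
    (hV : OrthogonalFamily ℝ (fun i => V i) fun i => (V i).subtypeₗᵢ) (w : H)
    {g : ι → ℝ} {C : ℝ} (hC : 0 ≤ C) (hg : ∀ i, |g i| ≤ C) (s : Finset ι) :
    ‖∑ i ∈ s, g i • (V i).starProjection w‖ ≤ C * ‖w‖ := by
  have h1 : ‖∑ i ∈ s, g i • (V i).starProjection w‖ ^ 2
      = ∑ i ∈ s, ‖g i • (V i).starProjection w‖ ^ 2 :=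
    hV.norm_sum (fun i => g i • (V i).orthogonalProjectionOnto w) s
  refine abs_le_of_sq_le_sq' ?_ (by positivity) |>.2
  calc _ = ∑ i ∈ s, |g i| ^ 2 * ‖(V i).starProjection w‖ ^ 2 := by
        simp only [h1, norm_smul, mul_pow, Real.norm_eq_abs]
    _ ≤ ∑ i ∈ s, C ^ 2 * ‖(V i).starProjection w‖ ^ 2 := by
        gcongr with i _
        exact hg i
    _ ≤ (C * ‖w‖) ^ 2 := by
        rw [← Finset.mul_sum, mul_pow]
        exact mul_le_mul_of_nonneg_left (sum_norm_sq_starProjection_le hV w s) (sq_nonneg C)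

theorem norm_tsum_smul_starProjection_le
    (hV : OrthogonalFamily ℝ (fun i => V i) fun i => (V i).subtypeₗᵢ) (w : H)
    {g : ι → ℝ} {C : ℝ} (hC : 0 ≤ C) (hg : ∀ i, |g i| ≤ C) :
    ‖∑' i, g i • (V i).starProjection w‖ ≤ C * ‖w‖ := by
  by_cases hs : Summable fun i => g i • (V i).starProjection w
  · exact le_of_tendsto hs.hasSum.norm
      (Eventually.of_forall (norm_sum_smul_starProjection_le hV w hC hg))
  -- A divergent sum has the junk value `0`, for which the bound is trivial.
  · rw [tsum_eq_zero_of_not_summable hs, norm_zero]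
    positivity

theorem starProjection_tsum_smul_starProjection
    (hV : OrthogonalFamily ℝ (fun i => V i) fun i => (V i).subtypeₗᵢ) (w : H)
    {g : ι → ℝ} (hg : Summable fun i => g i • (V i).starProjection w) (i : ι) :
    (V i).starProjection (∑' j, g j • (V j).starProjection w) = g i • (V i).starProjection w := by
  rw [(V i).starProjection.map_tsum hg, tsum_eq_single i]
  · rw [map_smul, Submodule.starProjection_eq_self_iff.2 (Submodule.starProjection_apply_mem _ _)]
  · intro j hj
    rw [map_smul, (Submodule.starProjection_apply_eq_zero_iff _).2, smul_zero]
    intro u hu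
    exact hV hj.symm ⟨u, hu⟩ ((V j).orthogonalProjectionOnto w)

variable [CompleteSpace H]

theorem summable_smul_starProjection
    (hV : OrthogonalFamily ℝ (fun i => V i) fun i => (V i).subtypeₗᵢ) (w : H)
    {g : ι → ℝ} {C : ℝ} (hg : ∀ i, |g i| ≤ C) :
    Summable fun i => g i • (V i).starProjection w := by
  refine (hV.summable_iff_norm_sq_summable fun i => g i • (V i).orthogonalProjectionOnto w).2 ?_
  refine Summable.of_nonneg_of_le (fun _ => sq_nonneg _) (fun i => ?_)
    ((summable_norm_sq_starProjection hV w).mul_left (C ^ 2))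
  rw [norm_smul, mul_pow, Real.norm_eq_abs]
  exact mul_le_mul_of_nonneg_right (pow_le_pow_left₀ (abs_nonneg _) (hg i) 2) (sq_nonneg _)

/-- Differentiation of a multiplier under the sum. The orthogonal series need not converge absolutely,
so the hypothesis is a first order Taylor estimate of the coefficients that is uniform in the index;
it bounds the remainder of the sum in norm. -/
theorem hasDerivAt_tsum_smul_starProjection
    (hV : OrthogonalFamily ℝ (fun i => V i) fun i => (V i).subtypeₗᵢ) (w : H)
    {g : ℝ → ι → ℝ} {g' : ι → ℝ} {s C : ℝ} (hC : 0 ≤ C)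
    (hg : ∀ᶠ t in 𝓝 s, ∃ K, ∀ i, |g t i| ≤ K) (hg' : ∃ K, ∀ i, |g' i| ≤ K)
    (hT : ∀ᶠ t in 𝓝 s, ∀ i, |g t i - g s i - (t - s) * g' i| ≤ C * (t - s) ^ 2) :
    HasDerivAt (fun t => ∑' i, g t i • (V i).starProjection w)
      (∑' i, g' i • (V i).starProjection w) s := by
  have hsum : ∀ {h : ι → ℝ}, (∃ K, ∀ i, |h i| ≤ K) →
      Summable fun i => h i • (V i).starProjection w :=
    fun ⟨_, hK⟩ => summable_smul_starProjection hV w hK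
  rw [hasDerivAt_iff_isLittleO]
  -- The remainder is itself a multiplier, with coefficients of size `C * (t - s) ^ 2`.
  have hO : (fun t => ∑' i, g t i • (V i).starProjection w - ∑' i, g s i • (V i).starProjection w
      - (t - s) • ∑' i, g' i • (V i).starProjection w) =O[𝓝 s] fun t => (t - s) ^ 2 := by
    refine Asymptotics.IsBigO.of_bound (C * ‖w‖) ?_
    filter_upwards [hg, hT] with t ht hTt
    have hs := hsum hg.self_of_nhds
    have heq : ∑' i, g t i • (V i).starProjection w - ∑' i, g s i • (V i).starProjection w
        - (t - s) • ∑' i, g' i • (V i).starProjection w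
        = ∑' i, (g t i - g s i - (t - s) * g' i) • (V i).starProjection w := by
      rw [← (hsum hg').tsum_const_smul, ← (hsum ht).tsum_sub hs,
        ← ((hsum ht).sub hs).tsum_sub ((hsum hg').const_smul _)]
      simp only [sub_smul, mul_smul]
    rw [heq, Real.norm_of_nonneg (sq_nonneg _)]
    calc _ ≤ C * (t - s) ^ 2 * ‖w‖ :=
          norm_tsum_smul_starProjection_le hV w (by positivity) hTt
      _ = _ := by ring
  refine hO.trans_isLittleO ?_
  simpa only [Real.norm_eq_abs, sq_abs] using
    Asymptotics.isLittleO_pow_sub_sub s (m := 2) one_lt_two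

end Multiplier

/-! ### Uniform estimates for exponentials -/

/-- For `x → +∞` the decay of `exp (-(s - r) x)` beats every power, and negative `x` range over a
bounded interval. -/
theorem exists_pow_mul_exp_le (M : ℝ) (k : ℕ) {s r : ℝ} (hr : 0 ≤ r) (hrs : r < s) :
    ∃ C, 0 ≤ C ∧ ∀ x, -M ≤ x → |x| ^ k * Real.exp (-s * x + r * |x|) ≤ C := by
  have hd : 0 < s - r := sub_pos.2 hrs
  refine ⟨max (k.factorial / (s - r) ^ k) (|M| ^ k * Real.exp ((s + r) * |M|)),
    le_max_of_le_right (by positivity), fun x hx => ?_⟩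
  rcases le_total 0 x with h0 | h0
  · refine le_max_of_le_left ?_
    have h1 := Real.pow_div_factorial_le_exp ((s - r) * x) (by positivity) k
    rw [abs_of_nonneg h0, le_div_iff₀ (by positivity)]
    rw [div_le_iff₀ (by positivity), mul_pow] at h1
    have h2 : Real.exp (-s * x + r * x) * Real.exp ((s - r) * x) = 1 := by
      rw [← Real.exp_add, ← Real.exp_zero]; ring_nf
    calc x ^ k * Real.exp (-s * x + r * x) * (s - r) ^ k
        = Real.exp (-s * x + r * x) * ((s - r) ^ k * x ^ k) := by ring
      _ ≤ Real.exp (-s * x + r * x) * (Real.exp ((s - r) * x) * k.factorial) := by gcongr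
      _ = k.factorial := by rw [← mul_assoc, h2, one_mul]
  · refine le_max_of_le_right ?_
    have h1 : |x| ≤ |M| := by
      rw [abs_of_nonpos h0]
      exact (neg_le.1 hx).trans (le_abs_self M)
    have h2 : -s * x + r * |x| = (s + r) * |x| := by rw [abs_of_nonpos h0]; ring
    rw [h2]
    have : 0 < s + r := by linarith
    gcongr

theorem abs_exp_sub_one_sub_id_le_sq_mul_exp (y : ℝ) :
    |Real.exp y - 1 - y| ≤ y ^ 2 * Real.exp |y| := by
  have h := Complex.norm_exp_sub_sum_le_norm_mul_exp (y : ℂ) 2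
  have e : Complex.exp y - ∑ m ∈ Finset.range 2, (y : ℂ) ^ m / m.factorial
      = ((Real.exp y - 1 - y : ℝ) : ℂ) := by
    simp [Finset.sum_range_succ]
    ring
  rw [e, Complex.norm_real, Complex.norm_real, Real.norm_eq_abs, Real.norm_eq_abs, sq_abs] at h
  exact h

/-- The functions `t ↦ (-x)^j exp (-t x)`, which are the `j`-th derivatives of `t ↦ exp (-t x)`, have
a first order Taylor remainder near `s > 0` that is uniform in `x ≥ -M`. -/
theorem exists_abs_taylor_exp_le (M : ℝ) (j : ℕ) {s : ℝ} (hs : 0 < s) :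
    ∃ C, 0 ≤ C ∧ ∀ t, |t - s| < s / 2 → ∀ x, -M ≤ x →
      |(-x) ^ j * Real.exp (-t * x) - (-x) ^ j * Real.exp (-s * x)
        - (t - s) * ((-x) ^ (j + 1) * Real.exp (-s * x))| ≤ C * (t - s) ^ 2 := by
  -- Since `|t - s| < s / 2`, the factor `exp |(t - s) x|` in the remainder takes up only half of the
  -- decay of `exp (-s x)`.
  obtain ⟨C, hC, h⟩ := exists_pow_mul_exp_le M (j + 2) (half_pos hs).le (half_lt_self hs)
  refine ⟨C, hC, fun t ht x hx => ?_⟩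
  have e : (-x) ^ j * Real.exp (-t * x) - (-x) ^ j * Real.exp (-s * x)
        - (t - s) * ((-x) ^ (j + 1) * Real.exp (-s * x))
      = (-x) ^ j * Real.exp (-s * x) * (Real.exp (-(t - s) * x) - 1 - -(t - s) * x) := by
    have : Real.exp (-t * x) = Real.exp (-s * x) * Real.exp (-(t - s) * x) := by
      rw [← Real.exp_add]; ring_nf
    rw [this]; ring
  have habs : |-(t - s) * x| ≤ s / 2 * |x| := by
    rw [abs_mul, abs_neg]
    gcongr
  rw [e, abs_mul, abs_mul, abs_pow, abs_neg, abs_of_pos (Real.exp_pos _)]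
  calc |x| ^ j * Real.exp (-s * x) * |Real.exp (-(t - s) * x) - 1 - -(t - s) * x|
      ≤ |x| ^ j * Real.exp (-s * x) * ((-(t - s) * x) ^ 2 * Real.exp (s / 2 * |x|)) := by
        gcongr
        exact (abs_exp_sub_one_sub_id_le_sq_mul_exp _).trans (by gcongr)
    _ = |x| ^ (j + 2) * Real.exp (-s * x + s / 2 * |x|) * (t - s) ^ 2 := by
        rw [Real.exp_add, pow_add, sq_abs]; ring
    _ ≤ C * (t - s) ^ 2 := by
        gcongr
        exact h x hx

/-! ### Smoothness of the control to state map -/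

/-- The formal `j`-th derivative `∑_λ (-log λ)^j λ^{-s} P_λ f` of the control to state map, with
`λ^{-s}` written as `exp (-s log λ)`. -/
noncomputable def stateDeriv {n : ℕ} (Ω : Set (Rn n)) (f : L2 Ω) (j : ℕ) (s : ℝ) : L2 Ω :=
  ∑' μ : Eigenvalue Ω,
    ((-Real.log μ.1) ^ j * Real.exp (-s * Real.log μ.1)) • (eigenspace Ω μ.1).starProjection f

section State

variable {n : ℕ} {Ω : Set (Rn n)} {c : ℝ}

theorem Eigenvalue.rpow_neg_eq_exp (hc : 0 < c) (h : ∀ μ : Eigenvalue Ω, c ≤ μ.1)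
    (μ : Eigenvalue Ω) (s : ℝ) : μ.1 ^ (-s) = Real.exp (-s * Real.log μ.1) := by
  rw [Real.rpow_def_of_pos (hc.trans_le (h μ)), mul_comm]

theorem controlToState_eq_stateDeriv_zero (hc : 0 < c) (h : ∀ μ : Eigenvalue Ω, c ≤ μ.1)
    (f : L2 Ω) : controlToState Ω f = stateDeriv Ω f 0 := by
  ext1 s
  simp only [controlToState, stateTerm, stateDeriv, eigenProj, pow_zero, one_mul,
    Eigenvalue.rpow_neg_eq_exp hc h]

theorem exists_abs_log_pow_mul_exp_le (hc : 0 < c) (h : ∀ μ : Eigenvalue Ω, c ≤ μ.1) (j : ℕ)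
    {s : ℝ} (hs : 0 < s) :
    ∃ K, ∀ μ : Eigenvalue Ω, |(-Real.log μ.1) ^ j * Real.exp (-s * Real.log μ.1)| ≤ K := by
  obtain ⟨C, -, hC⟩ := exists_pow_mul_exp_le (-Real.log c) j le_rfl hs
  refine ⟨C, fun μ => ?_⟩
  rw [abs_mul, abs_pow, abs_neg, abs_of_pos (Real.exp_pos _)]
  simpa using hC (Real.log μ.1) (by simpa using Real.log_le_log hc (h μ))

theorem summable_stateTerm (hc : 0 < c) (h : ∀ μ : Eigenvalue Ω, c ≤ μ.1) (f : L2 Ω)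
    {s : ℝ} (hs : 0 < s) : Summable (stateTerm Ω f s) := by
  obtain ⟨K, hK⟩ := exists_abs_log_pow_mul_exp_le hc h 0 hs
  refine summable_smul_starProjection (orthogonalFamily_eigenspace Ω) f
    (g := fun μ => μ.1 ^ (-s)) (C := K) fun μ => ?_
  simpa [Eigenvalue.rpow_neg_eq_exp hc h] using hK μ

theorem hasDerivAt_stateDeriv (hc : 0 < c) (h : ∀ μ : Eigenvalue Ω, c ≤ μ.1) (f : L2 Ω) (j : ℕ)
    {s : ℝ} (hs : 0 < s) : HasDerivAt (stateDeriv Ω f j) (stateDeriv Ω f (j + 1) s) s := by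
  obtain ⟨C, hC, hT⟩ := exists_abs_taylor_exp_le (-Real.log c) j hs
  refine hasDerivAt_tsum_smul_starProjection (orthogonalFamily_eigenspace Ω) f hC
    (g := fun t μ => (-Real.log μ.1) ^ j * Real.exp (-t * Real.log μ.1)) ?_
    (exists_abs_log_pow_mul_exp_le hc h (j + 1) hs) ?_
  · filter_upwards [lt_mem_nhds hs] with t ht
    exact exists_abs_log_pow_mul_exp_le hc h j ht
  · filter_upwards [Metric.ball_mem_nhds s (half_pos hs)] with t ht μ
    exact hT t (by simpa [Real.dist_eq] using ht) _ (by simpa using Real.log_le_log hc (h μ))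

theorem contDiffOn_stateDeriv (hc : 0 < c) (h : ∀ μ : Eigenvalue Ω, c ≤ μ.1) (f : L2 Ω)
    (m j : ℕ) : ContDiffOn ℝ m (stateDeriv Ω f j) (Ioi 0) := by
  induction m generalizing j with
  | zero =>
    exact contDiffOn_zero.2 fun s hs =>
      (hasDerivAt_stateDeriv hc h f j hs).continuousAt.continuousWithinAt
  | succ m ih =>
    push_cast
    refine (contDiffOn_succ_iff_deriv_of_isOpen isOpen_Ioi).2 ⟨fun s hs =>
      (hasDerivAt_stateDeriv hc h f j hs).differentiableAt.differentiableWithinAt, by simp, ?_⟩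
    exact (ih (j + 1)).congr fun s hs => (hasDerivAt_stateDeriv hc h f j hs).deriv

theorem controlToState_mem_Hs (hc : 0 < c) (h : ∀ μ : Eigenvalue Ω, c ≤ μ.1) (f : L2 Ω)
    {s : ℝ} (hs : 0 < s) : controlToState Ω f s ∈ Hs Ω s := by
  have hV := orthogonalFamily_eigenspace Ω
  have hproj : ∀ μ : Eigenvalue Ω, eigenProj Ω μ (controlToState Ω f s)
      = μ.1 ^ (-s) • eigenProj Ω μ f :=
    starProjection_tsum_smul_starProjection hV f (summable_stateTerm hc h f hs)
  obtain ⟨K, hK⟩ := exists_abs_log_pow_mul_exp_le hc h 0 hs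
  refine Summable.of_nonneg_of_le (fun μ => ?_) (fun μ => ?_)
    ((summable_norm_sq_starProjection hV f).mul_left K)
  · have := hc.trans_le (h μ)
    positivity
  · have hμ := hc.trans_le (h μ)
    have hle : μ.1 ^ (-s) ≤ K := by
      simpa [Eigenvalue.rpow_neg_eq_exp hc h] using hK μ
    have hmul : μ.1 ^ s * μ.1 ^ (-s) = 1 := by rw [← Real.rpow_add hμ]; simp
    rw [hproj, norm_smul, mul_pow, Real.norm_of_nonneg (by positivity)]
    calc μ.1 ^ s * ((μ.1 ^ (-s)) ^ 2 * ‖eigenProj Ω μ f‖ ^ 2)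
        = (μ.1 ^ s * μ.1 ^ (-s)) * μ.1 ^ (-s) * ‖eigenProj Ω μ f‖ ^ 2 := by ring
      _ ≤ K * ‖eigenProj Ω μ f‖ ^ 2 := by
        rw [hmul, one_mul]
        gcongr

end State

/-! ### The second derivative test -/

section OneVariable

variable {E : Type*} [NormedAddCommGroup E] [NormedSpace ℝ E] {U : Set ℝ} {s : ℝ}

theorem hasDerivAt_deriv_of_contDiffOn {g : ℝ → E} (hg : ContDiffOn ℝ 2 g U) (hU : U ∈ 𝓝 s) :
    HasDerivAt g (deriv g s) s ∧ HasDerivAt (deriv g) (iteratedDeriv 2 g s) s := by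
  have hgs := hg.contDiffAt hU
  refine ⟨(hgs.differentiableAt two_ne_zero).hasDerivAt, ?_⟩
  rw [iteratedDeriv_succ, iteratedDeriv_one]
  exact ((hgs.derivWithin (m := 1) (by norm_num)).differentiableAt one_ne_zero).hasDerivAt

/-- The second derivative test, with a strict minimum as its conclusion. -/
theorem eventually_lt_of_deriv_deriv_pos {g g' : ℝ → ℝ} {g'' : ℝ}
    (hg : ∀ᶠ t in 𝓝 s, HasDerivAt g (g' t) t) (hg' : HasDerivAt g' g'' s) (h0 : g' s = 0)
    (hpos : 0 < g'') : ∀ᶠ t in 𝓝 s, t ≠ s → g s < g t := by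
  -- Subtracting this parabola keeps the second derivative positive at `s`, so that a weak minimum of
  -- the difference `k` is a strict one of `g`.
  let k : ℝ → ℝ := fun t => g t - g'' / 4 * (t - s) ^ 2
  have hk : ∀ᶠ t in 𝓝 s, HasDerivAt k (g' t - g'' / 4 * (2 * (t - s))) t := by
    filter_upwards [hg] with t ht
    simpa using ht.fun_sub ((((hasDerivAt_id t).sub_const s).pow 2).const_mul (g'' / 4))
  have hdk : deriv k =ᶠ[𝓝 s] fun t => g' t - g'' / 4 * (2 * (t - s)) :=
    hk.mono fun t ht => ht.deriv
  have hddk : HasDerivAt (fun t => g' t - g'' / 4 * (2 * (t - s))) (g'' - g'' / 4 * 2) s := by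
    simpa using hg'.fun_sub ((((hasDerivAt_id s).sub_const s).const_mul 2).const_mul (g'' / 4))
  have hmin : IsLocalMin k s := by
    refine isLocalMin_of_deriv_deriv_pos ?_ ?_ hk.self_of_nhds.continuousAt
    · rw [hdk.deriv_eq, hddk.deriv]
      linarith
    · rw [hdk.self_of_nhds]
      simp [h0]
  filter_upwards [hmin] with t ht hne
  have hsq : 0 < (t - s) ^ 2 := by
    have := sub_ne_zero.2 hne
    positivity
  simp only [k, sub_self] at ht
  nlinarith

end OneVariable

/-! ### Derivatives of the reduced cost -/

section Cost

variable {n : ℕ} {Ω : Set (Rn n)} {ud : L2 Ω} {φ : ℝ → ℝ} {S : ℝ → L2 Ω} {s : ℝ}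

/-- The derivative of the reduced cost `t ↦ J(t, S(t))`. -/
theorem hasDerivAt_cost {S' : L2 Ω} {φ' : ℝ} (hS : HasDerivAt S S' s) (hφ : HasDerivAt φ φ' s) :
    HasDerivAt (fun t => cost ud φ t (S t)) (⟪S s - ud, S'⟫ + φ') s := by
  have h := (((hS.sub_const ud).norm_sq).const_mul (1 / 2 : ℝ)).add hφ
  convert! h using 1
  ring

/-- The second derivative of the reduced cost `t ↦ J(t, S(t))`. -/
theorem hasDerivAt_inner_sub_add {S' : ℝ → L2 Ω} {S'' : L2 Ω} {φ' : ℝ → ℝ} {φ'' : ℝ}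
    (hS : HasDerivAt S (S' s) s) (hS' : HasDerivAt S' S'' s) (hφ' : HasDerivAt φ' φ'' s) :
    HasDerivAt (fun t => ⟪S t - ud, S' t⟫ + φ' t) (⟪S' s, S' s⟫ + ⟪S s - ud, S''⟫ + φ'') s := by
  have h := ((hS.sub_const ud).inner ℝ hS').add hφ'
  convert! h using 1
  ring

end Cost

end FracIdent

theorem mainTheorem3 {n : ℕ} (hn : 1 ≤ n) (Ω : Set (FracIdent.Rn n)) (hΩ : IsOpen Ω)
    (hΩb : Bornology.IsBounded Ω) (f ud : FracIdent.L2 Ω)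
    (a b : ℝ) (ha : 0 ≤ a) (hab : a < b) (hb : b ≤ 1)
    (φ : ℝ → ℝ) (hφ : ContDiffOn ℝ 2 φ (Ioo a b)) (hφ_nonneg : ∀ s ∈ Ioo a b, 0 ≤ φ s)
    (hφ_convex : ConvexOn ℝ (Ioo a b) φ)
    (hφ_left : Tendsto φ (𝓝[>] a) atTop) (hφ_right : Tendsto φ (𝓝[<] b) atTop) :
    -- the state and its derivatives are well defined
    (∀ s ∈ Ioo (0 : ℝ) 1, Summable (FracIdent.stateTerm Ω f s)) ∧
    ContDiffOn ℝ 2 (FracIdent.controlToState Ω f) (Ioo 0 1) ∧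
    -- first order necessary condition
    (∀ (sbar : ℝ) (ubar : FracIdent.L2 Ω),
      FracIdent.IsOptimalPair Ω f ud φ a b sbar ubar →
        FracIdent.FirstOrder Ω f ud φ sbar ubar) ∧
    -- second order sufficient condition
    (∀ (sbar : ℝ) (ubar : FracIdent.L2 Ω), sbar ∈ Ioo a b →
      ubar = FracIdent.controlToState Ω f sbar →
      FracIdent.FirstOrder Ω f ud φ sbar ubar →
      FracIdent.SecondOrder Ω f ud φ sbar ubar →
        FracIdent.IsStrictLocallyOptimalPair Ω f ud φ a b sbar ubar) := by
  obtain ⟨c, hc, h⟩ := FracIdent.exists_pos_le_eigenvalue hn hΩb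
  have hS : ContDiffOn ℝ 2 (FracIdent.controlToState Ω f) (Ioo 0 1) := by
    rw [FracIdent.controlToState_eq_stateDeriv_zero hc h]
    exact (FracIdent.contDiffOn_stateDeriv hc h f 2 0).mono fun s hs => hs.1
  have hadm : ∀ s ∈ Ioo a b,
      FracIdent.IsAdmissible Ω f a b s (FracIdent.controlToState Ω f s) := fun s hs =>
    ⟨hs, FracIdent.controlToState_mem_Hs hc h f (ha.trans_lt hs.1), rfl⟩
  have hDS : ∀ s ∈ Ioo a b, _ := fun s hs =>
    FracIdent.hasDerivAt_deriv_of_contDiffOn hS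
      (Ioo_mem_nhds (ha.trans_lt hs.1) (hs.2.trans_le hb))
  have hDφ : ∀ s ∈ Ioo a b, _ := fun s hs =>
    FracIdent.hasDerivAt_deriv_of_contDiffOn hφ (Ioo_mem_nhds hs.1 hs.2)
  refine ⟨fun s hs => FracIdent.summable_stateTerm hc h f hs.1, hS, ?_, ?_⟩
  · rintro s _ ⟨⟨hs, -, rfl⟩, hopt⟩
    have hmin : IsLocalMin
        (fun t => FracIdent.cost ud φ t (FracIdent.controlToState Ω f t)) s := by
      filter_upwards [Ioo_mem_nhds hs.1 hs.2] with t ht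
      exact hopt t _ (hadm t ht)
    exact hmin.hasDerivAt_eq_zero (FracIdent.hasDerivAt_cost (hDS s hs).1 (hDφ s hs).1)
  · rintro s _ hs rfl hfirst hsecond
    refine ⟨hadm s hs, ?_⟩
    have hev := FracIdent.eventually_lt_of_deriv_deriv_pos
      (g := fun t => FracIdent.cost ud φ t (FracIdent.controlToState Ω f t))
      (eventually_of_mem (Ioo_mem_nhds hs.1 hs.2) fun t ht =>
        FracIdent.hasDerivAt_cost (hDS t ht).1 (hDφ t ht).1)
      (FracIdent.hasDerivAt_inner_sub_add (hDS s hs).1 (hDS s hs).2 (hDφ s hs).2) hfirst hsecond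
    obtain ⟨δ, hδ, hball⟩ := Metric.eventually_nhds_iff.1 hev
    refine ⟨δ, hδ, ?_⟩
    rintro t _ ⟨-, -, rfl⟩ ht hne
    exact hball (by rwa [Real.dist_eq]) hne
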